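/- For an integer $k\ge 0$ let $F_k$ be the free group on $k$ generators $x_1,\dots,x_k$. For $g\in F_k$ let $\|g\|$ be the least $r\ge 0$ such that $g$ is a product of $r$ elements, each of which is conjugate in $F_k$ to some $x_i$ or $x_i^{-1}$, and equip $F_k$ with the bi-invariant word metric $d_k(g,h)=\|gh^{-1}\|$. Theorem. Let $m\ge 0$ and $n\ge 2$ be integers and let $\varphi\colon F_m\to F_n$ be a group homomorphism. Then $\varphi$ is a quasi-isometry from $(F_m,d_m)$ to $(F_n,d_n)$ if and only if $\varphi$ is an isomorphism of groups. Here $\varphi$ is called a quasi-isometry if (1) there are real constants $C>0$ and $D\ge 0$ such that $\frac1C\,d_m(x,y)-D\le d_n(\varphi(x),\varphi(y))\le C\,d_m(x,y)+D$ for all $x,y\in F_m$; and (2) there is a real constant $B\ge 0$ such that for every $y\in F_n$ there is $x\in F_m$ with $d_n(\varphi(x),y)\le B$. -/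

import Mathlib

/-- The word norm of `g` with respect to `S`: the least length of an expression of `g` as a
product of elements of `S` and their inverses. -/
noncomputable def wordNorm {G : Type*} [Group G] (S : Set G) (g : G) : ℕ :=
  sInf {k : ℕ | ∃ l : List G, l.length = k ∧ (∀ s ∈ l, s ∈ S ∨ s⁻¹ ∈ S) ∧ l.prod = g}

/-- The closure of `S` under inverses and conjugation. -/
def conjInvClosure {G : Type*} [Group G] (S : Set G) : Set G :=
  {x : G | ∃ g s : G, (s ∈ S ∨ s⁻¹ ∈ S) ∧ x = g * s * g⁻¹}

/-- `S` normally generates `G`: its closure under inverses and conjugation generates `G`. -/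
def NormallyGenerates {G : Type*} [Group G] (S : Set G) : Prop :=
  Subgroup.closure (conjInvClosure S) = ⊤

/-- The conjugation-invariant word norm associated with `S`. -/
noncomputable def conjWordNorm {G : Type*} [Group G] (S : Set G) (g : G) : ℕ :=
  wordNorm (conjInvClosure S) g

section WordNorm

variable {G : Type*} [Group G]

theorem wordNorm_le {S : Set G} (l : List G) (hl : ∀ s ∈ l, s ∈ S ∨ s⁻¹ ∈ S) :
    wordNorm S l.prod ≤ l.length :=
  Nat.sInf_le ⟨l, rfl, hl, rfl⟩

/-- The minimum in the definition of the word norm is attained when `S` generates. -/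
theorem exists_list_wordNorm {S : Set G} (hS : Subgroup.closure S = ⊤) (g : G) :
    ∃ l : List G, l.length = wordNorm S g ∧ (∀ s ∈ l, s ∈ S ∨ s⁻¹ ∈ S) ∧ l.prod = g := by
  have hg : g ∈ Subgroup.closure S := by rw [hS]; trivial
  rw [← Subgroup.mem_toSubmonoid, Subgroup.closure_toSubmonoid] at hg
  obtain ⟨l, hl, hp⟩ := Submonoid.exists_list_of_mem_closure hg
  exact Nat.sInf_mem
    (s := {k : ℕ | ∃ l : List G, l.length = k ∧ (∀ s ∈ l, s ∈ S ∨ s⁻¹ ∈ S) ∧ l.prod = g})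
    ⟨l.length, l, rfl, hl, hp⟩

theorem wordNorm_one (S : Set G) : wordNorm S 1 = 0 :=
  Nat.le_zero.mp (wordNorm_le (S := S) [] (by simp))

theorem eq_one_of_wordNorm_eq_zero {S : Set G} (hS : Subgroup.closure S = ⊤) {g : G}
    (h : wordNorm S g = 0) : g = 1 := by
  obtain ⟨l, hl, -, rfl⟩ := exists_list_wordNorm hS g
  rw [h, List.length_eq_zero_iff] at hl
  simp [hl]

theorem wordNorm_mul_le {S : Set G} (hS : Subgroup.closure S = ⊤) (g h : G) :
    wordNorm S (g * h) ≤ wordNorm S g + wordNorm S h := by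
  obtain ⟨l, hl, hlS, hlg⟩ := exists_list_wordNorm hS g
  obtain ⟨k, hk, hkS, hkh⟩ := exists_list_wordNorm hS h
  rw [← hl, ← hk, ← List.length_append, ← hlg, ← hkh, ← List.prod_append]
  refine wordNorm_le _ fun s hs => ?_
  rcases List.mem_append.mp hs with hs | hs
  · exact hlS s hs
  · exact hkS s hs

theorem wordNorm_inv_le {S : Set G} (hS : Subgroup.closure S = ⊤) (g : G) :
    wordNorm S g⁻¹ ≤ wordNorm S g := by
  obtain ⟨l, hl, hlS, hlg⟩ := exists_list_wordNorm hS g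
  have key := wordNorm_le (S := S) (l.map fun x => x⁻¹).reverse (by
    intro s hs
    simp only [List.mem_reverse, List.mem_map] at hs
    obtain ⟨a, ha, rfl⟩ := hs
    rw [inv_inv]
    exact (hlS a ha).symm)
  rw [← List.prod_inv_reverse, hlg] at key
  simpa [hl] using key

theorem wordNorm_inv {S : Set G} (hS : Subgroup.closure S = ⊤) (g : G) :
    wordNorm S g⁻¹ = wordNorm S g :=
  le_antisymm (wordNorm_inv_le hS g) (by simpa using wordNorm_inv_le hS g⁻¹)

end WordNorm

/-- The bi-invariant word metric `d (x, y) = ‖x * y⁻¹‖` associated with a normally generating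
set `S`. -/
@[reducible]
noncomputable def biinvariantWordMetric {G : Type*} [Group G] (S : Set G)
    (hS : NormallyGenerates S) : MetricSpace G where
  dist x y := (conjWordNorm S (x * y⁻¹) : ℝ)
  dist_self x := by simp [conjWordNorm, wordNorm_one]
  dist_comm x y := by
    have h := wordNorm_inv hS (x * y⁻¹)
    rw [mul_inv_rev, inv_inv] at h
    exact_mod_cast h.symm
  dist_triangle x y z := by
    have h := wordNorm_mul_le hS (x * y⁻¹) (y * z⁻¹)
    rw [show x * y⁻¹ * (y * z⁻¹) = x * z⁻¹ by group] at h
    exact_mod_cast h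
  eq_of_dist_eq_zero {x y} h := by
    have h' : wordNorm (conjInvClosure S) (x * y⁻¹) = 0 := by exact_mod_cast h
    exact mul_inv_eq_one.mp (eq_one_of_wordNorm_eq_zero hS h')

/-- The standard generating set of the free group on `α`. -/
def freeGens (α : Type*) : Set (FreeGroup α) := Set.range FreeGroup.of

theorem normallyGenerates_freeGens (α : Type*) : NormallyGenerates (freeGens α) := by
  refine top_le_iff.mp ?_
  rw [← FreeGroup.closure_range_of α]
  refine Subgroup.closure_mono ?_
  intro x hx
  exact ⟨1, x, Or.inl hx, by simp⟩

/-- The free group of rank `n` carries the bi-invariant word metric associated with its standard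
generating set. -/
noncomputable instance freeGroupMetricSpace (n : ℕ) : MetricSpace (FreeGroup (Fin n)) :=
  biinvariantWordMetric (freeGens (Fin n)) (normallyGenerates_freeGens (Fin n))

/-- Quasi-isometries: coarsely bi-Lipschitz and coarsely surjective maps. -/
def IsQuasiIsometry {X Y : Type*} [MetricSpace X] [MetricSpace Y] (f : X → Y) : Prop :=
  (∃ C D : ℝ, 0 < C ∧ 0 ≤ D ∧ ∀ x y : X,
    1 / C * dist x y - D ≤ dist (f x) (f y) ∧ dist (f x) (f y) ≤ C * dist x y + D) ∧
  (∃ B : ℝ, 0 ≤ B ∧ ∀ y : Y, ∃ x : X, dist (f x) y ≤ B)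

/-! Isomorphisms are quasi-isometries because a homomorphism bounded on the finitely many generators
is Lipschitz, and this applies to the inverse as well. Conversely, the Brooks quasimorphism `brooks
w` is bounded by a multiple of the norm, yet grows linearly on the powers of a cyclically reduced
`w`. If these powers stay near a subgroup `K`, then `w` occurs in a reduced word of `K`
(`exists_isInfix_of_norm_le`). For finitely generated `K`, pigeonhole in a finite part of the coset
graph conjugates a positive power of `w` into `K` (`exists_conj_pow_mem`). With `K` trivial this
gives injectivity. Coarse density makes every cyclically reduced word occur in the image `H`, which
forces finite index (`finite_quotient_of_forall_isInfix`). For a basis element `z` and any `t`, some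
`z ^ M` and its conjugate by `t` lie in `H`; commutators of powers of `z` with `t` have bounded
norm, so the powers of the two preimages stay close. A conjugacy between powers of the preimages
then maps to one showing `t ∈ H⟨z⟩` (`exists_mul_zpow_of_norm_proper`). The case `z = x_i`, `t =
x_j` puts a primitive element `x_j x_i^(-e)` into `H`; using it as the new `z` gives that `H` is
everything. -/

/-! ### Counting subwords. -/

/-- The number of positions at which `w` occurs in a word as a contiguous subword. -/
def List.occurrences {β : Type*} [DecidableEq β] (w : List β) : List β → ℕ
  | [] => 0
  | x :: l => (if w <+: x :: l then 1 else 0) + List.occurrences w l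

namespace List

variable {β : Type*}

/-- A word of the length of `w` occurring in a power of `w` is a rotation of `w`. -/
theorem exists_rotation_of_isInfix_flatten_replicate {w u : List β} (hu : u.length = w.length)
    {k : ℕ} (h : u <:+: (replicate k w).flatten) : ∃ p v, w = p ++ v ∧ u = v ++ p := by
  obtain ⟨P, Q, h⟩ := h
  induction k generalizing P with
  | zero =>
    have : u = [] := by simp_all
    subst this
    exact ⟨[], [], by simpa [eq_comm] using hu, rfl⟩
  | succ k ih =>
    rw [replicate_succ, flatten_cons, append_assoc] at h
    rcases append_eq_append_iff.mp h with ⟨v, hw, hv⟩ | ⟨P', rfl, hv⟩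
    · rcases append_eq_append_iff.mp hv with ⟨c, hc, hc'⟩ | ⟨c, hc, hc'⟩
      · have h1 := congrArg length hw
        have h2 := congrArg length hc
        simp only [length_append] at h1 h2
        have hP : P = [] := length_eq_zero_iff.mp (by omega)
        have hc0 : c = [] := length_eq_zero_iff.mp (by omega)
        subst hP hc0
        exact ⟨[], w, by simp, by simp_all⟩
      · refine ⟨P, v, hw, ?_⟩
        have h1 := congrArg length hw
        have h2 := congrArg length hc
        simp only [length_append] at h1 h2
        cases k with
        | zero =>
          have : c = [] := by simp_all
          have : P = [] := length_eq_zero_iff.mp (by simp_all)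
          simp_all
        | succ k =>
          rw [replicate_succ, flatten_cons, hw, append_assoc] at hc'
          have := (append_inj hc' (by omega)).1
          rw [hc, this]
    · exact ih P' (by rw [append_assoc]; exact hv.symm)

variable [DecidableEq β]

theorem occurrences_add_le (w a b : List β) :
    occurrences w a + occurrences w b ≤ occurrences w (a ++ b) := by
  induction a with
  | nil => simp [occurrences]
  | cons x a ih =>
    simp only [cons_append, occurrences]
    have : w <+: x :: a → w <+: x :: (a ++ b) := fun h => h.trans ⟨b, by simp⟩
    split_ifs <;> first | omega | (exfalso; tauto)

/-- An occurrence straddling the junction starts among the last `w.length` letters of `a`. The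
minimum with `a.length` is what lets the induction on `a` close. -/
theorem occurrences_append_le_min (w a b : List β) :
    occurrences w (a ++ b) ≤ occurrences w a + occurrences w b + min a.length w.length := by
  induction a with
  | nil => simp [occurrences]
  | cons x a ih =>
    simp only [cons_append, occurrences, length_cons]
    have : w <+: x :: (a ++ b) → w.length ≤ a.length + 1 → w <+: x :: a := fun h hl =>
      prefix_of_prefix_length_le h (l₂ := x :: a) ⟨b, by simp⟩ (by simpa using hl)
    split_ifs <;> first | omega | (by_cases hl : w.length ≤ a.length + 1
                                   · exfalso; tauto
                                   · omega)

theorem occurrences_append_le (w a b : List β) :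
    occurrences w (a ++ b) ≤ occurrences w a + occurrences w b + w.length :=
  (occurrences_append_le_min w a b).trans (by omega)

theorem occurrences_le_length (w l : List β) : occurrences w l ≤ l.length := by
  induction l with
  | nil => simp [occurrences]
  | cons x l ih => simp only [occurrences, length_cons]; split_ifs <;> omega

theorem isInfix_of_occurrences_pos {w l : List β} (h : 0 < occurrences w l) : w <:+: l := by
  induction l with
  | nil => simp [occurrences] at h
  | cons x l ih =>
    simp only [occurrences] at h
    split_ifs at h with h'
    · exact h'.isInfix
    · exact (ih (by omega)).trans (suffix_cons x l).isInfix

theorem occurrences_self_pos {w : List β} (h : w ≠ []) : 0 < occurrences w w := by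
  cases w with
  | nil => exact absurd rfl h
  | cons x l => simp [occurrences]

theorem le_occurrences_flatten_replicate {w : List β} (h : w ≠ []) (k : ℕ) :
    k ≤ occurrences w (replicate k w).flatten := by
  induction k with
  | zero => simp
  | succ k ih =>
    rw [replicate_succ, flatten_cons]
    have := occurrences_add_le w w (replicate k w).flatten
    have := occurrences_self_pos h
    omega

end List

/-! ### Brooks quasimorphisms on free groups. -/

namespace FreeGroup

variable {α : Type*}

theorem IsReduced.append_of_head {a b : List (α × Bool)} (ha : IsReduced a) (hb : IsReduced b)
    (h : ∀ x ∈ a.getLast?, ∀ y ∈ b.head?, x.1 = y.1 → x.2 = y.2) : IsReduced (a ++ b) :=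
  List.IsChain.append ha hb h

variable [DecidableEq α]

theorem IsReduced.toWord_mk {L : List (α × Bool)} (h : IsReduced L) : (mk L).toWord = L := by
  rw [FreeGroup.toWord_mk, h.reduce_eq]

theorem exists_cancellation_of_isReduced (L₁ L₂ : List (α × Bool)) (h₁ : IsReduced L₁)
    (h₂ : IsReduced L₂) :
    ∃ a b c, L₁ = a ++ c ∧ L₂ = invRev c ++ b ∧ IsReduced (a ++ b) := by
  induction L₁ using List.reverseRecOn generalizing L₂ with
  | nil => exact ⟨[], L₂, [], rfl, rfl, h₂⟩
  | append_singleton L x ih =>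
    by_cases hred : IsReduced (L ++ [x] ++ L₂)
    · exact ⟨L ++ [x], L₂, [], by simp, by simp, hred⟩
    · cases L₂ with
      | nil => exact absurd (by simpa using h₁) hred
      | cons y L₂ =>
        have hy : x.1 = y.1 ∧ x.2 ≠ y.2 := by
          by_contra hxy
          refine hred (h₁.append_of_head h₂ ?_)
          simp only [List.getLast?_append, List.getLast?_singleton, List.head?_cons]
          intro a ha b hb
          simp at ha hb
          subst ha hb
          tauto
        obtain ⟨a, b, c, rfl, rfl, hab⟩ := ih L₂ (h₁.infix ⟨[], [x], by simp⟩)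
          (h₂.infix ⟨[y], [], by simp⟩)
        refine ⟨a, b, c ++ [x], by simp, ?_, hab⟩
        have : y = (x.1, !x.2) := Prod.ext hy.1.symm (Bool.eq_not.mpr (Ne.symm hy.2))
        simp [invRev, this]

/-- The reduced word of a product arises by cancelling a suffix of the first factor against a
prefix of the second one. -/
theorem exists_cancellation (g h : FreeGroup α) :
    ∃ a b c, g.toWord = a ++ c ∧ h.toWord = invRev c ++ b ∧ (g * h).toWord = a ++ b := by
  obtain ⟨a, b, c, hg, hh, hab⟩ :=
    exists_cancellation_of_isReduced g.toWord h.toWord isReduced_toWord isReduced_toWord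
  refine ⟨a, b, c, hg, hh, ?_⟩
  rw [← hab.toWord_mk]
  congr 1
  rw [← mk_toWord (x := g), ← mk_toWord (x := h), hg, hh, ← mul_mk, ← mul_mk, ← mul_mk, ← inv_mk]
  group

/-- The Brooks counting quasimorphism: occurrences of `w` in `g` minus those in `g⁻¹`. -/
def brooks (w : List (α × Bool)) (g : FreeGroup α) : ℤ :=
  List.occurrences w g.toWord - List.occurrences w g⁻¹.toWord

theorem brooks_inv (w : List (α × Bool)) (g : FreeGroup α) : brooks w g⁻¹ = -brooks w g := by
  simp [brooks]

/-- With `g = ac`, `h = c⁻¹b`, `gh = ab`, the counts in `c` and `c⁻¹` cancel. Each of the three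
values is then off only by its junction terms, at most `w.length` in absolute value. -/
theorem abs_brooks_mul_sub_le (w : List (α × Bool)) (g h : FreeGroup α) :
    |brooks w (g * h) - brooks w g - brooks w h| ≤ 3 * w.length := by
  obtain ⟨a, b, c, hg, hh, hgh⟩ := exists_cancellation g h
  simp only [brooks, toWord_inv, hg, hh, hgh, invRev_append, invRev_invRev]
  have h1 := List.occurrences_add_le w a b
  have h2 := List.occurrences_append_le w a b
  have h3 := List.occurrences_add_le w a c
  have h4 := List.occurrences_append_le w a c
  have h5 := List.occurrences_add_le w (invRev c) b
  have h6 := List.occurrences_append_le w (invRev c) b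
  have h7 := List.occurrences_add_le w (invRev b) (invRev a)
  have h8 := List.occurrences_append_le w (invRev b) (invRev a)
  have h9 := List.occurrences_add_le w (invRev c) (invRev a)
  have h10 := List.occurrences_append_le w (invRev c) (invRev a)
  have h11 := List.occurrences_add_le w (invRev b) c
  have h12 := List.occurrences_append_le w (invRev b) c
  rw [abs_le]
  omega

theorem abs_brooks_of_le (w : List (α × Bool)) (i : α) : |brooks w (of i)| ≤ 1 := by
  have h1 := List.occurrences_le_length w (of i).toWord
  have h2 := List.occurrences_le_length w (of i)⁻¹.toWord
  simp only [toWord_inv, invRev_length, toWord_of, List.length_singleton] at h1 h2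
  simp only [brooks, toWord_inv, toWord_of, abs_le]
  omega

theorem abs_brooks_of_mem_conjInvClosure (w : List (α × Bool)) {g : FreeGroup α}
    (hg : g ∈ conjInvClosure (freeGens α)) : |brooks w g| ≤ 1 + 6 * w.length := by
  obtain ⟨c, s, hs, rfl⟩ := hg
  have hs' : |brooks w s| ≤ 1 := by
    rcases hs with ⟨i, rfl⟩ | ⟨i, hi⟩
    · exact abs_brooks_of_le w i
    · rw [← inv_inv s, ← hi, brooks_inv, abs_neg]
      exact abs_brooks_of_le w i
  have h1 := abs_brooks_mul_sub_le w (c * s) c⁻¹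
  have h2 := abs_brooks_mul_sub_le w c s
  rw [brooks_inv] at h1
  rw [abs_le] at *
  omega

theorem abs_brooks_list_prod_le (w : List (α × Bool)) (l : List (FreeGroup α))
    (hl : ∀ s ∈ l, s ∈ conjInvClosure (freeGens α) ∨ s⁻¹ ∈ conjInvClosure (freeGens α)) :
    |brooks w l.prod| ≤ (1 + 9 * w.length) * l.length := by
  induction l with
  | nil => simp [brooks]
  | cons s l ih =>
    have h1 := ih fun s hs => hl s (List.mem_cons_of_mem _ hs)
    have h2 : |brooks w s| ≤ 1 + 6 * w.length := by
      rcases hl s List.mem_cons_self with h | h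
      · exact abs_brooks_of_mem_conjInvClosure w h
      · rw [← inv_inv s, brooks_inv, abs_neg]
        exact abs_brooks_of_mem_conjInvClosure w h
    have h3 := abs_brooks_mul_sub_le w s l.prod
    rw [List.prod_cons, List.length_cons]
    push_cast
    rw [mul_add, mul_one]
    generalize (1 + 9 * (w.length : ℤ)) * l.length = t at *
    rw [abs_le] at *
    omega

theorem abs_brooks_le (w : List (α × Bool)) (g : FreeGroup α) :
    |brooks w g| ≤ (1 + 9 * w.length) * conjWordNorm (freeGens α) g := by
  obtain ⟨l, hl, hmem, rfl⟩ := exists_list_wordNorm (normallyGenerates_freeGens α) g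
  rw [conjWordNorm, ← hl]
  exact abs_brooks_list_prod_le w l hmem

/-- Otherwise `w = pv` and `w⁻¹ = vp` as words, so `p` and `v` equal their own inverses.
Torsion-freeness makes both trivial. -/
theorem IsReduced.not_invRev_isInfix_flatten_replicate {w : List (α × Bool)} (hw : IsReduced w)
    (hne : w ≠ []) (k : ℕ) : ¬ invRev w <:+: (List.replicate k w).flatten := by
  intro h
  obtain ⟨p, v, rfl, h2⟩ := List.exists_rotation_of_isInfix_flatten_replicate invRev_length h
  rw [invRev_append] at h2
  obtain ⟨hv, hp⟩ := List.append_inj h2 invRev_length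
  have key : ∀ u : List (α × Bool), invRev u = u → mk u = 1 := fun u hu => by
    have : mk u ^ 2 = 1 := by
      rw [sq, mul_eq_one_iff_eq_inv, inv_mk, hu]
    exact (pow_eq_one_iff_left two_ne_zero).mp this
  have := hw.toWord_mk
  rw [← mul_mk, key _ hv, key _ hp, one_mul, toWord_one] at this
  exact hne this.symm

theorem IsCyclicallyReduced.toWord_mk_pow {w : List (α × Bool)} (hw : IsCyclicallyReduced w)
    (k : ℕ) : (mk w ^ k).toWord = (List.replicate k w).flatten := by
  rw [toWord_pow, hw.isReduced.toWord_mk, (hw.flatten_replicate k).isReduced.reduce_eq]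

theorem IsCyclicallyReduced.le_brooks_pow {w : List (α × Bool)} (hw : IsCyclicallyReduced w)
    (hne : w ≠ []) (k : ℕ) : k ≤ brooks w (mk w ^ k) := by
  have h1 := List.le_occurrences_flatten_replicate hne k
  have h2 : List.occurrences w (invRev (List.replicate k w).flatten) = 0 := by
    by_contra h
    obtain ⟨s, t, h⟩ := List.isInfix_of_occurrences_pos (Nat.pos_of_ne_zero h)
    refine hw.isReduced.not_invRev_isInfix_flatten_replicate hne k ⟨invRev t, invRev s, ?_⟩
    rw [← invRev_invRev (L₁ := (List.replicate k w).flatten), ← h]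
    simp [invRev_append]
  simp only [brooks, toWord_inv, hw.toWord_mk_pow, h2]
  omega

/-- If the powers of a cyclically reduced word stay at bounded distance from `K`, then the word
occurs in the reduced word of some element of `K`. -/
theorem IsCyclicallyReduced.exists_isInfix_of_norm_le {w : List (α × Bool)}
    (hw : IsCyclicallyReduced w) (K : Set (FreeGroup α)) (B : ℕ)
    (h : ∀ i : ℕ, ∃ k ∈ K, conjWordNorm (freeGens α) (mk w ^ i * k⁻¹) ≤ B) :
    ∃ k ∈ K, w <:+: k.toWord := by
  by_cases hne : w = []
  · obtain ⟨k, hk, -⟩ := h 0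
    exact ⟨k, hk, by simp [hne]⟩
  -- The exponent exceeds the bound on `brooks w (x * k⁻¹)` plus the defect, so `brooks w k` must be
  -- positive.
  obtain ⟨k, hk, hB⟩ := h ((1 + 9 * w.length) * B + 3 * w.length + 1)
  refine ⟨k, hk, List.isInfix_of_occurrences_pos ?_⟩
  have h1 := hw.le_brooks_pow hne ((1 + 9 * w.length) * B + 3 * w.length + 1)
  generalize mk w ^ ((1 + 9 * w.length) * B + 3 * w.length + 1) = x at *
  have h2 := abs_brooks_mul_sub_le w (x * k⁻¹) k
  have h3 := abs_brooks_le w (x * k⁻¹)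
  have h4 : (1 + 9 * (w.length : ℤ)) * conjWordNorm (freeGens α) (x * k⁻¹) ≤
      (1 + 9 * (w.length : ℤ)) * B := by gcongr
  rw [inv_mul_cancel_right] at h2
  push_cast at h1
  have : 0 < brooks w k := by
    generalize (1 + 9 * (w.length : ℤ)) * B = t at *
    rw [abs_le] at *
    omega
  rw [brooks] at this
  omega

end FreeGroup

/-! ### Conjugation-invariant norms and homomorphisms. -/

section ConjWordNorm

variable {G H : Type*} [Group G] [Group H]

theorem conj_mem_conjInvClosure {S : Set G} {x : G} (c : G) (hx : x ∈ conjInvClosure S) :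
    c * x * c⁻¹ ∈ conjInvClosure S := by
  obtain ⟨g, s, hs, rfl⟩ := hx
  exact ⟨c * g, s, hs, by group⟩

theorem conjWordNorm_conj_le {S : Set G} (hS : NormallyGenerates S) (c g : G) :
    conjWordNorm S (c * g * c⁻¹) ≤ conjWordNorm S g := by
  obtain ⟨l, hl, hmem, rfl⟩ := exists_list_wordNorm hS g
  have key := wordNorm_le (S := conjInvClosure S) (l.map (MulAut.conj c)) (by
    intro s hs
    obtain ⟨a, ha, rfl⟩ := List.mem_map.mp hs
    refine (hmem a ha).imp (conj_mem_conjInvClosure c) fun h => ?_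
    rw [← map_inv]
    exact conj_mem_conjInvClosure c h)
  rw [← map_list_prod, List.length_map, hl] at key
  exact key

theorem conjWordNorm_conj {S : Set G} (hS : NormallyGenerates S) (c g : G) :
    conjWordNorm S (c * g * c⁻¹) = conjWordNorm S g := by
  refine le_antisymm (conjWordNorm_conj_le hS c g) ?_
  have := conjWordNorm_conj_le hS c⁻¹ (c * g * c⁻¹)
  rwa [show c⁻¹ * (c * g * c⁻¹) * c⁻¹⁻¹ = g by group] at this

theorem conjWordNorm_inv {S : Set G} (hS : NormallyGenerates S) (g : G) :
    conjWordNorm S g⁻¹ = conjWordNorm S g :=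
  wordNorm_inv hS g

theorem conjWordNorm_mul_le {S : Set G} (hS : NormallyGenerates S) (g h : G) :
    conjWordNorm S (g * h) ≤ conjWordNorm S g + conjWordNorm S h :=
  wordNorm_mul_le hS g h

/-- The bound does not depend on `g`, so it is uniform when `g` runs over all powers of an element
or over a whole subgroup. -/
theorem conjWordNorm_commutator_le {S : Set G} (hS : NormallyGenerates S) (g h : G) :
    conjWordNorm S (g * h * g⁻¹ * h⁻¹) ≤ 2 * conjWordNorm S h := by
  have h1 := conjWordNorm_mul_le hS (g * h * g⁻¹) h⁻¹
  rw [conjWordNorm_conj hS, conjWordNorm_inv hS] at h1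
  omega

/-- A homomorphism that is bounded by `L` on a normally generating set is `L`-Lipschitz. -/
theorem conjWordNorm_map_le {S : Set G} {T : Set H} (hS : NormallyGenerates S)
    (hT : NormallyGenerates T) (f : G →* H) (L : ℕ) (hL : ∀ s ∈ S, conjWordNorm T (f s) ≤ L)
    (g : G) : conjWordNorm T (f g) ≤ L * conjWordNorm S g := by
  have hgen : ∀ x ∈ conjInvClosure S, conjWordNorm T (f x) ≤ L := by
    rintro _ ⟨c, s, hs, rfl⟩
    rw [map_mul, map_mul, map_inv, conjWordNorm_conj hT]
    rcases hs with hs | hs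
    · exact hL s hs
    · rw [← conjWordNorm_inv hT, ← map_inv]
      exact hL _ hs
  obtain ⟨l, hl, hmem, rfl⟩ := exists_list_wordNorm hS g
  rw [conjWordNorm, conjWordNorm, ← hl]
  clear hl
  induction l with
  | nil => simp [wordNorm_one]
  | cons s l ih =>
    have h1 := ih fun s hs => hmem s (List.mem_cons_of_mem _ hs)
    have h2 : conjWordNorm T (f s) ≤ L := by
      rcases hmem s List.mem_cons_self with h | h
      · exact hgen s h
      · rw [← conjWordNorm_inv hT, ← map_inv]
        exact hgen _ h
    rw [List.prod_cons, map_mul, List.length_cons, mul_add, mul_one]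
    refine (conjWordNorm_mul_le hT _ _).trans ?_
    rw [add_comm]
    exact add_le_add h1 h2

end ConjWordNorm

/-! ### Powers staying near a finitely generated subgroup. -/

namespace FreeGroup

variable {α : Type*}

theorem mk_flatten_replicate (w : List (α × Bool)) (j : ℕ) :
    mk (List.replicate j w).flatten = mk w ^ j :=
  (pow_mk j).symm

variable [DecidableEq α]

/-- For a finitely generated subgroup `K`, the reduced words of elements of `K` trace paths inside a
finite part of the Schreier coset graph of `K`. -/
theorem exists_finite_prefix_cosets {K : Subgroup (FreeGroup α)} (hK : K.FG) :
    ∃ S : Set (FreeGroup α ⧸ K), S.Finite ∧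
      ∀ k ∈ K, ∀ p, p <+: k.toWord → (((mk p)⁻¹ : FreeGroup α) : FreeGroup α ⧸ K) ∈ S := by
  obtain ⟨T, rfl⟩ := hK
  obtain ⟨S, hS, base⟩ : ∃ S : Set (FreeGroup α ⧸ Subgroup.closure (T : Set (FreeGroup α))),
      S.Finite ∧ ∀ g ∈ (T : Set (FreeGroup α)) ∪ {1}, ∀ p, p <+: g.toWord →
        (((mk p)⁻¹ : FreeGroup α) : FreeGroup α ⧸ Subgroup.closure (T : Set (FreeGroup α))) ∈ S :=
    ⟨⋃ g ∈ (T : Set (FreeGroup α)) ∪ {1}, (fun p => (((mk p)⁻¹ : FreeGroup α) :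
        FreeGroup α ⧸ Subgroup.closure (T : Set (FreeGroup α)))) '' {p | p ∈ g.toWord.inits},
      (T.finite_toSet.union (Set.finite_singleton 1)).biUnion fun g _ =>
        (List.finite_toSet _).image _,
      fun g hg p hp => Set.mem_biUnion hg ⟨p, by simpa using hp, rfl⟩⟩
  refine ⟨S, hS, fun k hk => ?_⟩
  induction hk using Subgroup.closure_induction with
  | mem x hx => exact base x (Or.inl hx)
  | one => exact base 1 (Or.inr rfl)
  | mul x y hx hy ihx ihy =>
    rintro p ⟨q, hp⟩
    obtain ⟨a, b, c, hxw, hyw, hw⟩ := exists_cancellation x y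
    rw [hw] at hp
    -- A prefix of the product is a prefix of `x`, or `x` times a prefix of `y`; in the latter case
    -- `x ∈ K` does not affect the coset.
    rcases List.append_eq_append_iff.mp hp with ⟨d, rfl, -⟩ | ⟨d, rfl, rfl⟩
    · exact ihx p ⟨d ++ c, by rw [hxw, List.append_assoc]⟩
    · have h1 := ihy (invRev c ++ d) ⟨q, by rw [hyw, List.append_assoc]⟩
      have h2 : mk (a ++ d) = x * mk (invRev c ++ d) := by
        rw [← mk_toWord (x := x), hxw]
        simp only [← mul_mk, ← inv_mk]
        group
      rw [h2, mul_inv_rev]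
      convert h1 using 1
      rw [QuotientGroup.eq]
      convert hx using 1
      group
  | inv x hx ih =>
    rintro p ⟨q, hp⟩
    rw [toWord_inv] at hp
    have h1 : x.toWord = invRev q ++ invRev p := by
      rw [← invRev_invRev (L₁ := x.toWord), ← hp, invRev_append]
    have h2 := ih (invRev q) ⟨_, h1.symm⟩
    have h3 : (mk p)⁻¹ = (mk (invRev q))⁻¹ * x := by
      rw [← mk_toWord (x := x), h1, ← mul_mk, inv_mul_cancel_left, inv_mk]
    rw [h3]
    convert h2 using 1
    rw [QuotientGroup.eq]
    convert inv_mem hx using 1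
    group

theorem exists_conj_pow_mem_of_isCyclicallyReduced {w : List (α × Bool)}
    (hw : IsCyclicallyReduced w) {K : Subgroup (FreeGroup α)} (hK : K.FG) (B : ℕ)
    (h : ∀ i : ℕ, ∃ k ∈ K, conjWordNorm (freeGens α) (mk w ^ i * k⁻¹) ≤ B) :
    ∃ (P : FreeGroup α) (i : ℕ), i ≠ 0 ∧ P * mk w ^ i * P⁻¹ ∈ K := by
  obtain ⟨S, hS, hSK⟩ := exists_finite_prefix_cosets hK
  set j := hS.toFinset.card with hj
  -- A subword `w ^ j` gives `j + 1` prefixes `P w ^ s` with only `j` available cosets, so two of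
  -- them coincide.
  obtain ⟨k, hk, P, Q, hPQ⟩ := (hw.flatten_replicate j).exists_isInfix_of_norm_le K B fun i => by
    rw [mk_flatten_replicate, ← pow_mul]
    exact h (j * i)
  have hmem : ∀ s ∈ Finset.range (j + 1),
      (((mk P * mk w ^ s)⁻¹ : FreeGroup α) : FreeGroup α ⧸ K) ∈ hS.toFinset := by
    intro s hs
    rw [Finset.mem_range] at hs
    rw [Set.Finite.mem_toFinset, ← mk_flatten_replicate, mul_mk]
    refine hSK k hk _ ⟨(List.replicate (j - s) w).flatten ++ Q, ?_⟩
    rw [← hPQ, show List.replicate j w = List.replicate s w ++ List.replicate (j - s) w by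
      rw [← List.replicate_add, Nat.add_sub_cancel' (by omega)]]
    simp only [List.flatten_append, List.append_assoc]
  obtain ⟨s, -, s', -, hne, heq⟩ :=
    Finset.exists_ne_map_eq_of_card_lt_of_maps_to (by simp [hj]) hmem
  wlog hlt : s < s' generalizing s s'
  · exact this s' s hne.symm heq.symm (by omega)
  rw [eq_comm, QuotientGroup.eq, inv_inv, mul_inv_rev] at heq
  refine ⟨mk P, s' - s, by omega, ?_⟩
  convert heq using 1
  rw [show mk w ^ s' = mk w ^ (s' - s) * mk w ^ s by rw [← pow_add, Nat.sub_add_cancel hlt.le]]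
  group

/-- If all powers of `g` are at bounded distance from a finitely generated subgroup `K`, then a
nontrivial power of `g` is conjugate into `K`. -/
theorem exists_conj_pow_mem (g : FreeGroup α) {K : Subgroup (FreeGroup α)} (hK : K.FG) (B : ℕ)
    (h : ∀ i : ℕ, ∃ k ∈ K, conjWordNorm (freeGens α) (g ^ i * k⁻¹) ≤ B) :
    ∃ (P : FreeGroup α) (i : ℕ), i ≠ 0 ∧ P * g ^ i * P⁻¹ ∈ K := by
  set c := mk (reduceCyclically.conjugator g.toWord)
  set w := reduceCyclically g.toWord
  have hg : g = c * mk w * c⁻¹ := by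
    rw [← mk_toWord (x := g), ← reduceCyclically.conj_conjugator_reduceCyclically g.toWord,
      ← mul_mk, ← mul_mk, ← inv_mk]
  have hS := normallyGenerates_freeGens α
  obtain ⟨P, i, hi, hP⟩ := exists_conj_pow_mem_of_isCyclicallyReduced (w := w)
    (reduceCyclically.isCyclicallyReduced isReduced_toWord) hK
    (B + 2 * conjWordNorm (freeGens α) c) fun i => by
      obtain ⟨k, hk, hB⟩ := h i
      refine ⟨k, hk, ?_⟩
      -- Multiplying by a commutator of `k` and `c` replaces `g` by its cyclically reduced core
      -- without conjugating `K`, at bounded cost.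
      have h1 := conjWordNorm_mul_le hS (g ^ i * k⁻¹) (k * c * k⁻¹ * c⁻¹)
      have h2 := conjWordNorm_commutator_le hS k c
      rw [← conjWordNorm_conj hS c]
      rw [show g ^ i * k⁻¹ * (k * c * k⁻¹ * c⁻¹) = c * (mk w ^ i * k⁻¹) * c⁻¹ by
        rw [hg, conj_pow]; group] at h1
      omega
  refine ⟨P * c⁻¹, i, hi, ?_⟩
  convert hP using 1
  rw [hg, conj_pow]
  group

end FreeGroup

/-! ### Finite index, roots and centralizers of generators. -/

namespace FreeGroup

variable {α : Type*}

theorem exists_isCyclicallyReduced_append [Nontrivial α] {w : List (α × Bool)}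
    (hw : IsReduced w) : ∃ v, IsCyclicallyReduced (w ++ v) := by
  cases w with
  | nil => exact ⟨[], by simp⟩
  | cons b L =>
    set a := (b :: L).getLast (by simp) with ha
    have hlast : ∀ x ∈ (b :: L).getLast?, x = a := fun x hx => by
      rw [List.getLast?_eq_some_getLast (by simp)] at hx
      simpa [eq_comm, ha] using hx
    obtain ⟨c, hac, hcb⟩ : ∃ c : α × Bool, (a.1 = c.1 → a.2 = c.2) ∧ (c.1 = b.1 → c.2 = b.2) := by
      by_cases h : a.1 = b.1
      · obtain ⟨i, hi⟩ := exists_ne a.1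
        exact ⟨(i, true), fun h' => absurd h'.symm hi, fun h' => absurd (h'.trans h.symm) hi⟩
      · exact ⟨a, fun _ => rfl, fun h' => absurd h' h⟩
    refine ⟨[c], isCyclicallyReduced_cons_append_iff.mpr ⟨hw.append_of_head .singleton ?_, hcb⟩⟩
    intro x hx y hy
    obtain rfl := hlast x hx
    obtain rfl : c = y := by simpa using hy
    exact hac

variable [DecidableEq α]

theorem finite_quotient_of_forall_isInfix [Nontrivial α] {H : Subgroup (FreeGroup α)} (hH : H.FG)
    (h : ∀ w : List (α × Bool), IsCyclicallyReduced w → ∃ k ∈ H, w <:+: k.toWord) :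
    Finite (FreeGroup α ⧸ H) := by
  obtain ⟨S, hS, hSH⟩ := exists_finite_prefix_cosets hH
  -- `R w` collects the starting vertices from which `w` can be read inside `S`. It shrinks as `w`
  -- is extended, so for a minimal `w` it no longer changes.
  let R : List (α × Bool) → Set (FreeGroup α ⧸ H) := fun w =>
    {s | ∀ u, u <+: w → (mk u)⁻¹ • s ∈ S}
  have hRS : ∀ w, R w ⊆ S := fun w s hs => by
    have := hs [] List.nil_prefix
    rwa [← one_eq_mk, inv_one, one_smul] at this
  have hRne : ∀ w, IsReduced w → (R w).Nonempty := fun w hw => by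
    obtain ⟨v, hv⟩ := exists_isCyclicallyReduced_append hw
    obtain ⟨k, hk, P, Q, hPQ⟩ := h _ hv
    refine ⟨(((mk P)⁻¹ : FreeGroup α) : FreeGroup α ⧸ H), ?_⟩
    rintro u ⟨q, rfl⟩
    rw [MulAction.Quotient.smul_coe, smul_eq_mul, ← mul_inv_rev, mul_mk]
    exact hSH k hk _ ⟨q ++ v ++ Q, by rw [← hPQ]; simp⟩
  obtain ⟨w, ⟨hw, hwne⟩, hmin⟩ := (measure fun w => (R w).ncard).wf.has_min
    {w | IsReduced w ∧ w ≠ []} ⟨[(Classical.arbitrary α, true)], by simp⟩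
  have hext : ∀ u, IsReduced (w ++ u) → R (w ++ u) = R w := fun u hu =>
    Set.eq_of_subset_of_ncard_le (fun s hs p hp => hs p (hp.trans (List.prefix_append w u)))
      (not_lt.mp (hmin (w ++ u) ⟨hu, by simp [hwne]⟩)) (hS.subset (hRS w))
  obtain ⟨s, hs⟩ := hRne w hw
  set v := (mk w)⁻¹ • s with hv
  have hread : ∀ u, IsReduced (w ++ u) → (mk u)⁻¹ • v ∈ S := fun u hu => by
    have := (hext u hu).ge hs (w ++ u) List.prefix_rfl
    rwa [← mul_mk, mul_inv_rev, mul_smul] at this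
  set a := w.getLast hwne with ha
  have hlast : ∀ x ∈ w.getLast?, x = a := fun x hx => by
    rw [List.getLast?_eq_some_getLast hwne] at hx
    simpa [eq_comm, ha] using hx
  have hall : ∀ u, IsReduced u → (mk u)⁻¹ • v ∈ S := fun u hu => by
    by_cases hwu : IsReduced (w ++ u)
    · exact hread u hwu
    obtain ⟨y, hy, hay⟩ : ∃ y ∈ u.head?, a.1 = y.1 := by
      by_contra! hcon
      refine hwu (hw.append_of_head hu fun x hx y hy hxy => ?_)
      rw [hlast x hx] at hxy
      exact absurd hxy (hcon y hy)
    obtain ⟨i, hi⟩ := exists_ne a.1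
    have hb : ∀ k, IsReduced (w ++ List.replicate k (i, true)) := fun k =>
      hw.append_of_head (List.isChain_replicate_of_rel _ fun _ => rfl) fun x hx z hz hxz => by
        rw [hlast x hx] at hxz
        have := List.eq_of_mem_replicate (List.mem_of_mem_head? hz)
        rw [this] at hxz
        exact absurd hxz.symm hi
    have hpow : ∀ k, mk (List.replicate k ((i, true) : α × Bool)) = of i ^ k := fun k => by
      rw [← toWord_of_pow, mk_toWord]
    -- If `u` does not extend `w`, a loop at `v` labelled by a power of another generator is
    -- inserted between them. It exists because these powers stay in the finite set `S`.
    obtain ⟨k, hk, hkv⟩ : ∃ k : ℕ, k ≠ 0 ∧ (of i ^ k)⁻¹ • v = v := by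
      obtain ⟨k, -, l, -, hkl, heq⟩ := Set.infinite_univ.exists_ne_map_eq_of_mapsTo
        (f := fun k : ℕ => (of i ^ k)⁻¹ • v) (t := S)
        (fun k _ => by simpa only [hpow] using hread _ (hb k)) hS
      wlog hlt : k < l generalizing k l
      · exact this l k hkl.symm heq.symm (by omega)
      refine ⟨l - k, by omega, ?_⟩
      rw [show of i ^ l = of i ^ (l - k) * of i ^ k by rw [← pow_add, Nat.sub_add_cancel hlt.le],
        show (of i ^ (l - k) * of i ^ k)⁻¹ = (of i ^ k)⁻¹ * (of i ^ (l - k))⁻¹ by group,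
        mul_smul, smul_left_cancel_iff] at heq
      exact heq.symm
    have hred : IsReduced (w ++ List.replicate k (i, true) ++ u) := by
      refine (hb k).append_of_head hu fun x hx z hz hxz => ?_
      rw [List.getLast?_append, List.getLast?_replicate, if_neg hk] at hx
      obtain rfl : (i, true) = x := by simpa using hx
      obtain rfl : y = z := Option.some_inj.mp (hy.symm.trans hz)
      exact absurd (hxz.trans hay.symm) hi
    have := hread (List.replicate k (i, true) ++ u) (by rwa [← List.append_assoc])
    rwa [← mul_mk, mul_inv_rev, mul_smul, hpow, hkv] at this
  have htop : S = Set.univ := by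
    refine Set.eq_univ_of_forall fun q => ?_
    obtain ⟨g, rfl⟩ := MulAction.exists_smul_eq (FreeGroup α) v q
    have := hall g⁻¹.toWord isReduced_toWord
    rwa [mk_toWord, inv_inv] at this
  exact Set.finite_univ_iff.mp (htop ▸ hS)

/-- Leading letters `x_i^±1` can be stripped off. With any other leading letter, `x_i u` is reduced;
equality of lengths makes `u x_i` reduced too, and the first letters disagree. -/
theorem mem_zpowers_of_commute_of {i : α} {u : FreeGroup α} (h : u * of i = of i * u) :
    u ∈ Subgroup.zpowers (of i) := by
  generalize hn : u.toWord.length = n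
  induction n using Nat.strong_induction_on generalizing u with
  | _ n ih =>
    cases hu : u.toWord with
    | nil =>
      rw [toWord_eq_nil_iff] at hu
      exact hu ▸ one_mem _
    | cons y L =>
      have hred : IsReduced (y :: L) := hu ▸ isReduced_toWord
      have hL : (mk L).toWord = L := (hred.infix ⟨[y], [], by simp⟩).toWord_mk
      have huy : u = mk [y] * mk L := by rw [← mk_toWord (x := u), hu, mul_mk]; rfl
      by_cases hy : y.1 = i
      · have hy' : mk [y] ∈ Subgroup.zpowers (of i) := by
          obtain ⟨j, _ | _⟩ := y
          · obtain rfl : j = i := hy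
            exact inv_mem (Subgroup.mem_zpowers (of j))
          · obtain rfl : j = i := hy
            exact Subgroup.mem_zpowers (of j)
        rw [huy]
        refine mul_mem hy' (ih L.length (by simp [← hn, hu]) ?_ (by rw [hL]))
        have hc : mk [y] * of i = of i * mk [y] := by
          obtain ⟨e, he⟩ := Subgroup.mem_zpowers_iff.mp hy'
          rw [← he, ← zpow_add_one, ← zpow_one_add, add_comm]
        rw [huy, mul_assoc, ← mul_assoc (of i), ← hc, mul_assoc] at h
        exact mul_left_cancel h
      · exfalso
        have h1 : (of i * u).toWord = (i, true) :: y :: L := by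
          have : IsReduced ((i, true) :: y :: L) :=
            isReduced_cons_cons.mpr ⟨fun h' => absurd h'.symm hy, hred⟩
          rw [← this.toWord_mk, ← mk_toWord (x := u), hu]
          rfl
        obtain ⟨a, b, c, ha, hb, hab⟩ := exists_cancellation u (of i)
        rw [h, h1] at hab
        rw [toWord_of] at hb
        rw [hu] at ha
        have l1 := congrArg List.length ha
        have l2 := congrArg List.length hb
        have l3 := congrArg List.length hab
        simp only [List.length_append, invRev_length, List.length_cons, List.length_nil] at l1 l2 l3
        have hc : c = [] := List.length_eq_zero_iff.mp (by omega)
        subst hc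
        rw [List.append_nil] at ha
        subst ha
        simp only [List.cons_append, List.cons.injEq] at hab
        exact hy (congrArg Prod.fst hab.1).symm

/-- The exponent sum forces `k = l`, and uniqueness of roots reduces to a commuting pair. -/
theorem mem_zpowers_of_conj_pow {i : α} {u : FreeGroup α} {k : ℕ} {l : ℤ} (hk : k ≠ 0)
    (h : u * of i ^ k * u⁻¹ = of i ^ l) : u ∈ Subgroup.zpowers (of i) := by
  let f : FreeGroup α →* Multiplicative ℤ := lift fun _ => Multiplicative.ofAdd 1
  have hkl : (k : ℤ) = l := by
    have := congrArg (fun x => (f x).toAdd) h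
    simpa [f] using this
  rw [← hkl, zpow_natCast, ← conj_pow] at h
  exact mem_zpowers_of_commute_of (mul_inv_eq_iff_eq_mul.mp (pow_left_injective hk h))

/-- The Nielsen automorphism multiplying the generator `j` on the right by a power of another
generator `i`. -/
def transvection {i j : α} (hij : i ≠ j) (e : ℤ) : FreeGroup α ≃* FreeGroup α :=
  MonoidHom.toMulEquiv
    (lift fun k => if k = j then of j * of i ^ e else of k)
    (lift fun k => if k = j then of j * of i ^ (-e) else of k)
    (by
      ext k
      by_cases hk : k = j <;> simp [hk, hij])
    (by
      ext k
      by_cases hk : k = j <;> simp [hk, hij])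

theorem transvection_of {i j : α} (hij : i ≠ j) (e : ℤ) :
    transvection hij e (of j) = of j * of i ^ e := by
  simp [transvection]

end FreeGroup

/-! ### Coarse injectivity and density imply bijectivity. -/

namespace FreeGroup

variable {α β : Type*}

/-- A homomorphism of free groups which is coarsely injective for the bi-invariant word norms is
injective. -/
theorem injective_of_norm_proper (φ : FreeGroup β →* FreeGroup α)
    (hproper : ∀ b : ℕ, ∃ b' : ℕ, ∀ g, conjWordNorm (freeGens α) (φ g) ≤ b →
      conjWordNorm (freeGens β) g ≤ b') : Function.Injective φ := by
  classical
  refine (injective_iff_map_eq_one φ).mpr fun g hg => ?_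
  obtain ⟨b, hb⟩ := hproper 0
  obtain ⟨P, i, hi, hP⟩ := exists_conj_pow_mem g (K := ⊥) Subgroup.FG.bot b fun i =>
    ⟨1, one_mem _, hb _ (by simp [hg, conjWordNorm, wordNorm_one])⟩
  rw [Subgroup.mem_bot, conj_eq_one_iff] at hP
  exact (pow_eq_one_iff_left hi).mp hP

theorem finite_quotient_range_of_norm_dense [Nontrivial α] [Finite β]
    (φ : FreeGroup β →* FreeGroup α)
    (hdense : ∃ b : ℕ, ∀ y, ∃ x, conjWordNorm (freeGens α) (y * (φ x)⁻¹) ≤ b) :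
    Finite (FreeGroup α ⧸ φ.range) := by
  classical
  obtain ⟨b, hb⟩ := hdense
  refine finite_quotient_of_forall_isInfix ((Group.fg_iff_subgroup_fg _).mp inferInstance)
    fun w hw => hw.exists_isInfix_of_norm_le (φ.range : Set (FreeGroup α)) b fun i => ?_
  obtain ⟨x, hx⟩ := hb (mk w ^ i)
  exact ⟨φ x, ⟨x, rfl⟩, hx⟩

/-- Let `φ` be coarsely injective with image of finite index, and let `z` be such that only powers
of `z` conjugate a nontrivial power of `z` to a power of `z`. Then `φ.range * ⟨z⟩` is everything. -/
theorem exists_mul_zpow_of_norm_proper (φ : FreeGroup β →* FreeGroup α)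
    (hproper : ∀ b : ℕ, ∃ b' : ℕ, ∀ g, conjWordNorm (freeGens α) (φ g) ≤ b →
      conjWordNorm (freeGens β) g ≤ b')
    (hfin : Finite (FreeGroup α ⧸ φ.range)) {z : FreeGroup α}
    (hz : ∀ (u : FreeGroup α) (k : ℕ) (l : ℤ), k ≠ 0 → u * z ^ k * u⁻¹ = z ^ l →
      u ∈ Subgroup.zpowers z) (t : FreeGroup α) :
    ∃ h ∈ φ.range, ∃ e : ℤ, t = h * z ^ e := by
  classical
  have : φ.range.FiniteIndex := Subgroup.finiteIndex_of_finite_quotient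
  obtain ⟨M, hM, -, hzM⟩ := Subgroup.exists_pow_mem_of_index_ne_zero
    (Subgroup.FiniteIndex.index_ne_zero (H := φ.range.normalCore)) z
  obtain ⟨a, ha⟩ := Subgroup.normalCore_le _ hzM
  obtain ⟨b, hb⟩ := Subgroup.normalCore_le _
    ((Subgroup.normalCore_normal φ.range).conj_mem _ hzM t)
  obtain ⟨B, hB⟩ := hproper (2 * conjWordNorm (freeGens α) t)
  -- `a ^ i * b ^ (-i)` maps to the commutator of `z ^ (M * i)` and `t`, whose norm is at most twice
  -- that of `t` for every `i`.
  obtain ⟨P, i, hi, r, hr⟩ := exists_conj_pow_mem a (K := Subgroup.zpowers b)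
    (Subgroup.fg_iff _ |>.mpr ⟨{b}, (Subgroup.zpowers_eq_closure b).symm, Set.finite_singleton b⟩)
    B fun i => ⟨b ^ i, Subgroup.npow_mem_zpowers b i, hB _ (by
      convert conjWordNorm_commutator_le (normallyGenerates_freeGens α) (z ^ (M * i)) t using 2
      rw [_root_.map_mul, _root_.map_inv, _root_.map_pow, _root_.map_pow, ha, hb, conj_pow,
        ← pow_mul]
      group)⟩
  have hr' := congrArg φ hr
  simp only [_root_.map_mul, _root_.map_inv, _root_.map_pow, map_zpow, ha, hb, conj_zpow] at hr'
  have := hz (t⁻¹ * φ P) (M * i) (M * r) (mul_ne_zero hM.ne' hi) (by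
    rw [pow_mul, zpow_mul, zpow_natCast]
    calc t⁻¹ * φ P * (z ^ M) ^ i * (t⁻¹ * φ P)⁻¹
        = t⁻¹ * (φ P * (z ^ M) ^ i * (φ P)⁻¹) * t := by group
      _ = _ := by rw [← hr']; group)
  obtain ⟨e, he⟩ := Subgroup.mem_zpowers_iff.mp this
  refine ⟨φ P, ⟨P, rfl⟩, -e, ?_⟩
  rw [zpow_neg, he]
  group

theorem surjective_of_norm_proper_of_dense [Nontrivial α] [Finite β]
    (φ : FreeGroup β →* FreeGroup α)
    (hproper : ∀ b : ℕ, ∃ b' : ℕ, ∀ g, conjWordNorm (freeGens α) (φ g) ≤ b →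
      conjWordNorm (freeGens β) g ≤ b')
    (hdense : ∃ b : ℕ, ∀ y, ∃ x, conjWordNorm (freeGens α) (y * (φ x)⁻¹) ≤ b) :
    Function.Surjective φ := by
  classical
  have hfin := finite_quotient_range_of_norm_dense φ hdense
  obtain ⟨i, j, hij⟩ := exists_pair_ne α
  obtain ⟨h, hh, e, he⟩ := exists_mul_zpow_of_norm_proper φ hproper hfin
    (fun u k l hk => mem_zpowers_of_conj_pow (i := i) hk) (of j)
  let σ := transvection hij (-e)
  have hσ : σ (of j) = h := by
    rw [transvection_of, he, zpow_neg, mul_inv_cancel_right]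
  -- Here `z = σ (of j)` is the element `h` of the image, and it inherits the hypothesis on
  -- conjugate powers from `of j` through `σ`. The factor `z ^ d` is then absorbed by the image.
  have key := exists_mul_zpow_of_norm_proper φ hproper hfin (z := σ (of j))
    (fun u k l hk hu => by
      have h1 := congrArg σ.symm hu
      simp only [_root_.map_mul, _root_.map_inv, _root_.map_pow, map_zpow,
        MulEquiv.symm_apply_apply] at h1
      obtain ⟨d, hd⟩ := mem_zpowers_of_conj_pow hk h1
      refine ⟨d, ?_⟩
      have h2 := congrArg σ hd
      simpa using h2)
  intro t
  obtain ⟨g, hg, d, rfl⟩ := key t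
  rw [hσ]
  exact mul_mem hg (zpow_mem hh d)

end FreeGroup

/-! ### From metrics to norms, and the main theorem. -/

theorem dist_freeGroup {n : ℕ} (x y : FreeGroup (Fin n)) :
    dist x y = (conjWordNorm (freeGens (Fin n)) (x * y⁻¹) : ℝ) :=
  rfl

theorem IsQuasiIsometry.norm_proper {m n : ℕ} {φ : FreeGroup (Fin m) →* FreeGroup (Fin n)}
    (h : IsQuasiIsometry (φ : FreeGroup (Fin m) → FreeGroup (Fin n))) (b : ℕ) :
    ∃ b' : ℕ, ∀ g, conjWordNorm (freeGens (Fin n)) (φ g) ≤ b →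
      conjWordNorm (freeGens (Fin m)) g ≤ b' := by
  obtain ⟨⟨C, D, hC, -, hCD⟩, -⟩ := h
  refine ⟨⌈C * (b + D)⌉₊, fun g hg => Nat.cast_le.mp (le_trans ?_ (Nat.le_ceil _))⟩
  have h1 := (hCD g 1).1
  simp only [dist_freeGroup, map_one, inv_one, mul_one] at h1
  have h2 : (conjWordNorm (freeGens (Fin n)) (φ g) : ℝ) ≤ b := by exact_mod_cast hg
  rw [← div_le_iff₀' hC]
  have h3 : 1 / C * (conjWordNorm (freeGens (Fin m)) g : ℝ) =
    conjWordNorm (freeGens (Fin m)) g / C := by ring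
  linarith

theorem IsQuasiIsometry.norm_dense {m n : ℕ} {φ : FreeGroup (Fin m) →* FreeGroup (Fin n)}
    (h : IsQuasiIsometry (φ : FreeGroup (Fin m) → FreeGroup (Fin n))) :
    ∃ b : ℕ, ∀ y, ∃ x, conjWordNorm (freeGens (Fin n)) (y * (φ x)⁻¹) ≤ b := by
  obtain ⟨-, B, -, hB⟩ := h
  refine ⟨⌈B⌉₊, fun y => ?_⟩
  obtain ⟨x, hx⟩ := hB y
  rw [dist_comm, dist_freeGroup] at hx
  exact ⟨x, Nat.cast_le.mp (hx.trans (Nat.le_ceil _))⟩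

theorem exists_dist_map_le {m n : ℕ} (φ : FreeGroup (Fin m) →* FreeGroup (Fin n)) :
    ∃ L : ℕ, ∀ x y, dist (φ x) (φ y) ≤ L * dist x y := by
  refine ⟨Finset.univ.sup fun i => conjWordNorm (freeGens (Fin n)) (φ (.of i)), fun x y => ?_⟩
  rw [dist_freeGroup, dist_freeGroup, ← map_inv, ← map_mul]
  have := conjWordNorm_map_le (normallyGenerates_freeGens (Fin m))
    (normallyGenerates_freeGens (Fin n)) φ
    (Finset.univ.sup fun i => conjWordNorm (freeGens (Fin n)) (φ (.of i)))
    (by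
      rintro _ ⟨i, rfl⟩
      exact Finset.le_sup (f := fun i => conjWordNorm (freeGens (Fin n)) (φ (.of i)))
        (Finset.mem_univ i))
    (x * y⁻¹)
  exact_mod_cast this

theorem MulEquiv.isQuasiIsometry_freeGroup {m n : ℕ}
    (e : FreeGroup (Fin m) ≃* FreeGroup (Fin n)) : IsQuasiIsometry e := by
  obtain ⟨L₁, h₁⟩ := exists_dist_map_le e.toMonoidHom
  obtain ⟨L₂, h₂⟩ := exists_dist_map_le e.symm.toMonoidHom
  -- One constant serves both inequalities; the summand 1 keeps it positive when both Lipschitz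
  -- constants vanish.
  refine ⟨⟨L₁ + L₂ + 1, 0, by positivity, le_rfl, fun x y => ?_⟩, 0, le_rfl, fun y =>
    ⟨e.symm y, by simp⟩⟩
  have h1 := h₁ x y
  have h2 := h₂ (e x) (e y)
  simp only [MulEquiv.coe_toMonoidHom, MulEquiv.symm_apply_apply] at h1 h2
  have d1 := dist_nonneg (x := x) (y := y)
  have d2 := dist_nonneg (x := e x) (y := e y)
  have l1 : (0 : ℝ) ≤ L₁ := Nat.cast_nonneg _
  have l2 : (0 : ℝ) ≤ L₂ := Nat.cast_nonneg _
  constructor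
  · rw [sub_zero, one_div, inv_mul_le_iff₀ (by positivity)]
    nlinarith [mul_nonneg l1 d2]
  · nlinarith [mul_nonneg l2 d1]

theorem theorem1 (m n : ℕ) (hn : 2 ≤ n) (φ : FreeGroup (Fin m) →* FreeGroup (Fin n)) :
    IsQuasiIsometry (φ : FreeGroup (Fin m) → FreeGroup (Fin n)) ↔
      ∃ e : FreeGroup (Fin m) ≃* FreeGroup (Fin n), (e : FreeGroup (Fin m) →* FreeGroup (Fin n)) = φ := by
  constructor
  · intro h
    have : Nontrivial (Fin n) := Fin.nontrivial_iff_two_le.mpr hn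
    exact ⟨MulEquiv.ofBijective φ ⟨FreeGroup.injective_of_norm_proper φ h.norm_proper,
      FreeGroup.surjective_of_norm_proper_of_dense φ h.norm_proper h.norm_dense⟩, rfl⟩
  · rintro ⟨e, rfl⟩
    exact e.isQuasiIsometry_freeGroup
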